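/- Let $\Omega\subset\mathbb R^3$ be a bounded domain with smooth boundary, let $1<p<3$, $a,b>0$, $\lambda\in\mathbb R$, and let $u_0\in H^2(\Omega)\cap H^1_0(\Omega)$, $u_1\in H^1_0(\Omega)$. Consider the Kirchhoff problem $$u_{tt}-\Big(a\int_\Omega|\nabla u|^2\,dx+b\Big)\Delta u=\lambda u+|u|^{p-1}u\quad (t>0,\ x\in\Omega),\qquad u=0\ \text{ on }\partial\Omega,\qquad u(0)=u_0,\quad u_t(0)=u_1 .$$ For $0<T\le\infty$, a solution on $[0,T)$ is a function $$u\in C([0,T);H^2(\Omega)\cap H^1_0(\Omega))\cap C^1([0,T);H^1_0(\Omega))\cap C^2([0,T);L^2(\Omega))$$ that takes the initial values and satisfies the equation in $L^2(\Omega)$ for every $t\in(0,T)$. Let $u$ be a solution on $[0,T_{\max})$, where $T_{\max}\in(0,\infty]$ is the maximal existence time (no solution with the same initial data exists on $[0,T')$ with $T'>T_{\max}$). Put $$\lambda_1=\inf\{\|\nabla v\|_2^2: v\in H^1_0(\Omega),\ \|v\|_2=1\},\qquad S_{p+1}=\inf_{v\in H^1_0(\Omega)\setminus\{0\}}\frac{\|\nabla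 v\|_2^2}{\|v\|_{p+1}^2},\qquad b_0=\begin{cases}b-\lambda/\lambda_1,&\lambda\ge0,\\ b,&\lambda<0,\end{cases}$$ $$E(0)=\tfrac12\|u_1\|_2^2+\tfrac a4\|\nabla u_0\|_2^4+\tfrac b2\|\nabla u_0\|_2^2-\tfrac\lambda2\|u_0\|_2^2-\tfrac1{p+1}\|u_0\|_{p+1}^{p+1}.$$ Theorem 2.2. (1) There is a constant $K_1>0$ (which may depend on $u$ but not on $t$) such that $$\|u_t(t)\|_2+\|\nabla u(t)\|_2\le K_1\qquad\text{for all }t\in[0,T_{\max}).$$ (2) If moreover $\lambda<b\lambda_1$, $E(0)\le0$ and $\|\nabla u_0\|_2>0$, then $$\|\nabla u(t)\|_2\ \ge\ \Big(\frac{p+1}2\,b_0\,S_{p+1}^{(p+1)/2}\Big)^{1/(p-1)}\qquad\text{for all }t\in[0,T_{\max}).$$ Part (2) is asserted for every $a>0$, in particular for all sufficiently small $a>0$. -/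

import Mathlib

open MeasureTheory Set Topology
open scoped ContDiff

noncomputable section

namespace Kirchhoff

/-- Euclidean three-space. -/
abbrev E3 : Type := EuclideanSpace ℝ (Fin 3)

/-- A bounded domain (non-empty connected open set) of `ℝ³` with `C^∞` boundary: near each
boundary point, `Ω` is the sublevel set of a smooth function with non-vanishing differential. -/
structure IsSmoothBoundedDomain (Ω : Set E3) : Prop where
  isOpen : IsOpen Ω
  isConnected : IsConnected Ω
  isBounded : Bornology.IsBounded Ω
  smooth_boundary : ∀ x ∈ frontier Ω, ∃ U : Set E3, IsOpen U ∧ x ∈ U ∧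
    ∃ ρ : E3 → ℝ, ContDiffOn ℝ ∞ ρ U ∧ fderiv ℝ ρ x ≠ 0 ∧ Ω ∩ U = {y ∈ U | ρ y < 0}

/-- The real Hilbert space `L²(Ω)`. -/
abbrev L2 (Ω : Set E3) : Type := Lp ℝ 2 (volume.restrict Ω)

/-- The classical partial derivative `∂φ/∂xᵢ`. -/
def partialDeriv (i : Fin 3) (φ : E3 → ℝ) (x : E3) : ℝ :=
  fderiv ℝ φ x (EuclideanSpace.single i 1)

/-- `φ ∈ C_c^∞(Ω)`. -/
structure IsTestFunction (Ω : Set E3) (φ : E3 → ℝ) : Prop where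
  smooth : ContDiff ℝ ∞ φ
  hasCompactSupport : HasCompactSupport φ
  tsupport_subset : tsupport φ ⊆ Ω

/-- `g` is the weak partial derivative `∂f/∂xᵢ` of `f` in `Ω`. -/
def IsWeakPartial (Ω : Set E3) (i : Fin 3) (f g : L2 Ω) : Prop :=
  ∀ φ : E3 → ℝ, IsTestFunction Ω φ →
    ∫ x in Ω, f x * partialDeriv i φ x = -∫ x in Ω, g x * φ x

section Linear

variable {Ω : Set E3} {φ ψ : E3 → ℝ}

theorem IsTestFunction.zero : IsTestFunction Ω (fun _ => 0) :=
  ⟨contDiff_const, HasCompactSupport.zero, by simp [tsupport, Function.support]⟩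

theorem IsTestFunction.add (hφ : IsTestFunction Ω φ) (hψ : IsTestFunction Ω ψ) :
    IsTestFunction Ω (fun x => φ x + ψ x) :=
  ⟨hφ.smooth.add hψ.smooth, hφ.hasCompactSupport.add hψ.hasCompactSupport,
    (tsupport_add φ ψ).trans (union_subset hφ.tsupport_subset hψ.tsupport_subset)⟩

theorem IsTestFunction.const_mul (c : ℝ) (hφ : IsTestFunction Ω φ) :
    IsTestFunction Ω (fun x => c * φ x) :=
  ⟨contDiff_const.mul hφ.smooth, hφ.hasCompactSupport.mul_left,
    (tsupport_mul_subset_right).trans hφ.tsupport_subset⟩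

theorem IsTestFunction.differentiableAt (hφ : IsTestFunction Ω φ) (x : E3) :
    DifferentiableAt ℝ φ x :=
  (hφ.smooth.differentiable (by simp)).differentiableAt

theorem IsTestFunction.partialDeriv_add (hφ : IsTestFunction Ω φ) (hψ : IsTestFunction Ω ψ)
    (i : Fin 3) (x : E3) :
    partialDeriv i (fun y => φ y + ψ y) x = partialDeriv i φ x + partialDeriv i ψ x := by
  simp [partialDeriv, fderiv_fun_add (hφ.differentiableAt x) (hψ.differentiableAt x)]

theorem IsTestFunction.partialDeriv_const_mul (c : ℝ) (hφ : IsTestFunction Ω φ)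
    (i : Fin 3) (x : E3) :
    partialDeriv i (fun y => c * φ y) x = c * partialDeriv i φ x := by
  simp [partialDeriv, fderiv_const_mul (hφ.differentiableAt x)]

theorem IsTestFunction.memLp (hφ : IsTestFunction Ω φ) : MemLp φ 2 (volume.restrict Ω) :=
  (hφ.smooth.continuous.memLp_of_hasCompactSupport hφ.hasCompactSupport).restrict Ω

theorem IsTestFunction.memLp_partialDeriv (hφ : IsTestFunction Ω φ) (i : Fin 3) :
    MemLp (partialDeriv i φ) 2 (volume.restrict Ω) := by
  have hc : Continuous (partialDeriv i φ) :=
    (hφ.smooth.continuous_fderiv (by simp)).clm_apply continuous_const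
  have hs : HasCompactSupport (partialDeriv i φ) := hφ.hasCompactSupport.fderiv_apply ℝ _
  exact (hc.memLp_of_hasCompactSupport hs).restrict Ω

theorem IsWeakPartial.zero (i : Fin 3) : IsWeakPartial Ω i 0 0 := by
  intro φ _
  have h0 := Lp.coeFn_zero ℝ 2 (volume.restrict Ω)
  rw [integral_congr_ae (g := fun _ => (0 : ℝ)) (by filter_upwards [h0] with x hx; simp only [hx, Pi.zero_apply, zero_mul]),
    integral_congr_ae (f := fun x => (0 : L2 Ω) x * φ x) (g := fun _ => (0 : ℝ))
      (by filter_upwards [h0] with x hx; simp only [hx, Pi.zero_apply, zero_mul])]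
  simp

theorem IsWeakPartial.add {i : Fin 3} {f g f' g' : L2 Ω} (h : IsWeakPartial Ω i f g)
    (h' : IsWeakPartial Ω i f' g') : IsWeakPartial Ω i (f + f') (g + g') := by
  intro φ hφ
  have e1 : ∫ x in Ω, (f + f') x * partialDeriv i φ x
      = ∫ x in Ω, (f x * partialDeriv i φ x + f' x * partialDeriv i φ x) :=
    integral_congr_ae (by
      filter_upwards [Lp.coeFn_add f f'] with x hx
      simp only [hx, Pi.add_apply, add_mul])
  have e2 : ∫ x in Ω, (g + g') x * φ x = ∫ x in Ω, (g x * φ x + g' x * φ x) :=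
    integral_congr_ae (by
      filter_upwards [Lp.coeFn_add g g'] with x hx
      simp only [hx, Pi.add_apply, add_mul])
  have i1 (k : L2 Ω) : Integrable (fun x => k x * partialDeriv i φ x) (volume.restrict Ω) :=
    (Lp.memLp k).integrable_mul (hφ.memLp_partialDeriv i)
  have i2 (k : L2 Ω) : Integrable (fun x => k x * φ x) (volume.restrict Ω) :=
    (Lp.memLp k).integrable_mul hφ.memLp
  rw [e1, e2, integral_add (i1 f) (i1 f'), integral_add (i2 g) (i2 g'), h φ hφ, h' φ hφ]
  ring

theorem IsWeakPartial.smul {i : Fin 3} {f g : L2 Ω} (c : ℝ) (h : IsWeakPartial Ω i f g) :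
    IsWeakPartial Ω i (c • f) (c • g) := by
  intro φ hφ
  have e1 : ∫ x in Ω, (c • f) x * partialDeriv i φ x
      = ∫ x in Ω, c * (f x * partialDeriv i φ x) :=
    integral_congr_ae (by
      filter_upwards [Lp.coeFn_smul c f] with x hx
      simp [hx, mul_assoc])
  have e2 : ∫ x in Ω, (c • g) x * φ x = ∫ x in Ω, c * (g x * φ x) :=
    integral_congr_ae (by
      filter_upwards [Lp.coeFn_smul c g] with x hx
      simp [hx, mul_assoc])
  rw [e1, e2, integral_const_mul, integral_const_mul, h φ hφ]
  ring

end Linear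

/-- Pairs `(f, (gᵢ))` of a function and candidates for its first partial derivatives. The product
norm is equivalent to the usual `H¹` norm. -/
abbrev Jet1 (Ω : Set E3) : Type := L2 Ω × (Fin 3 → L2 Ω)

/-- Triples `(f, (gᵢ), (hᵢⱼ))` of a function and candidates for its partial derivatives of first
and second order. The product norm is equivalent to the usual `H²` norm. -/
abbrev Jet2 (Ω : Set E3) : Type := L2 Ω × (Fin 3 → L2 Ω) × (Fin 3 → Fin 3 → L2 Ω)

/-- The space `C_c^∞(Ω)`, each `φ` being recorded as `(φ, ∇φ)`. -/
def testJets (Ω : Set E3) : Submodule ℝ (Jet1 Ω) where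
  carrier := {v | ∃ φ : E3 → ℝ, IsTestFunction Ω φ ∧ v.1 =ᵐ[volume.restrict Ω] φ ∧
    ∀ i, v.2 i =ᵐ[volume.restrict Ω] partialDeriv i φ}
  zero_mem' := by
    refine ⟨_, IsTestFunction.zero, Lp.coeFn_zero ℝ 2 _, fun i => ?_⟩
    filter_upwards [Lp.coeFn_zero ℝ 2 (volume.restrict Ω)] with x hx
    simpa [partialDeriv] using hx
  add_mem' := by
    rintro v w ⟨φ, hφ, h1, h2⟩ ⟨ψ, hψ, k1, k2⟩
    refine ⟨_, hφ.add hψ, ?_, fun i => ?_⟩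
    · filter_upwards [Lp.coeFn_add v.1 w.1, h1, k1] with x hx hx1 hx2
      simp only [hx, hx1, hx2, Prod.fst_add, Pi.add_apply]
    · filter_upwards [Lp.coeFn_add (v.2 i) (w.2 i), h2 i, k2 i] with x hx hx1 hx2
      simp only [hx, hx1, hx2, Prod.snd_add, Pi.add_apply, hφ.partialDeriv_add hψ]
  smul_mem' := by
    rintro c v ⟨φ, hφ, h1, h2⟩
    refine ⟨_, hφ.const_mul c, ?_, fun i => ?_⟩
    · filter_upwards [Lp.coeFn_smul c v.1, h1] with x hx hx1
      simp [hx, hx1]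
    · filter_upwards [Lp.coeFn_smul c (v.2 i), h2 i] with x hx hx1
      simp [hx, hx1, hφ.partialDeriv_const_mul]

/-- `H¹₀(Ω)`: the closure of `C_c^∞(Ω)` in the `H¹` norm. An element `u` is recorded together with
its gradient, as `(u, ∇u)`. -/
def H10 (Ω : Set E3) : Submodule ℝ (Jet1 Ω) := (testJets Ω).topologicalClosure

/-- `H²(Ω)`: the functions in `L²(Ω)` whose weak derivatives of first and second order lie in
`L²(Ω)`. An element `u` is recorded together with its derivatives, as `(u, (∂ᵢu), (∂ⱼ∂ᵢu))`. -/
def H2 (Ω : Set E3) : Submodule ℝ (Jet2 Ω) where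
  carrier := {v | (∀ i, IsWeakPartial Ω i v.1 (v.2.1 i)) ∧
    ∀ i j, IsWeakPartial Ω j (v.2.1 i) (v.2.2 i j)}
  zero_mem' := ⟨fun i => IsWeakPartial.zero i, fun _ j => IsWeakPartial.zero j⟩
  add_mem' := fun hv hw => ⟨fun i => (hv.1 i).add (hw.1 i), fun i j => (hv.2 i j).add (hw.2 i j)⟩
  smul_mem' := fun c _ hv => ⟨fun i => (hv.1 i).smul c, fun i j => (hv.2 i j).smul c⟩

/-- `H²(Ω) ∩ H¹₀(Ω)`, with the norm of `H²(Ω)`. -/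
def H2H10 (Ω : Set E3) : Submodule ℝ (Jet2 Ω) where
  carrier := {v | v ∈ H2 Ω ∧ (v.1, v.2.1) ∈ H10 Ω}
  zero_mem' := ⟨(H2 Ω).zero_mem, (H10 Ω).zero_mem⟩
  add_mem' := fun hv hw => ⟨(H2 Ω).add_mem hv.1 hw.1, (H10 Ω).add_mem hv.2 hw.2⟩
  smul_mem' := fun c _ hv => ⟨(H2 Ω).smul_mem c hv.1, (H10 Ω).smul_mem c hv.2⟩

/-- The inclusion of `H²(Ω) ∩ H¹₀(Ω)` in `H¹₀(Ω)`. -/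
def toH10 {Ω : Set E3} (v : H2H10 Ω) : H10 Ω := ⟨(v.1.1, v.1.2.1), v.2.2⟩

/-- The inclusion of `H¹₀(Ω)` in `L²(Ω)`. -/
def toL2 {Ω : Set E3} (v : H10 Ω) : L2 Ω := v.1.1

/-- The Laplacian `Δv ∈ L²(Ω)`. -/
def laplacian {Ω : Set E3} (v : H2H10 Ω) : L2 Ω := ∑ i, v.1.2.2 i i

/-- The Dirichlet norm `‖∇v‖₂ = (∫_Ω |∇v|² dx)^{1/2}`. -/
def gradNorm {Ω : Set E3} (v : H10 Ω) : ℝ := √(∑ i, ‖v.1.2 i‖ ^ 2)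

/-- The norm `‖v‖_q` of `L^q(Ω)`, for `v ∈ H¹₀(Ω)` and `0 < q < ∞`. -/
def qNorm {Ω : Set E3} (q : ℝ) (v : H10 Ω) : ℝ :=
  (eLpNorm (toL2 v) (ENNReal.ofReal q) (volume.restrict Ω)).toReal

/-- The principal Dirichlet eigenvalue `λ₁` of `-Δ` on `Ω`:
the infimum of `‖∇v‖₂²` over `v ∈ H¹₀(Ω)` with `‖v‖₂ = 1`. -/
def lambda1 (Ω : Set E3) : ℝ :=
  sInf {r | ∃ v : H10 Ω, ‖toL2 v‖ = 1 ∧ r = gradNorm v ^ 2}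

/-- The optimal Sobolev constant `S_q` of the embedding of `H¹₀(Ω)` in `L^q(Ω)`. -/
def sobolevConst (Ω : Set E3) (q : ℝ) : ℝ :=
  sInf {r | ∃ v : H10 Ω, v ≠ 0 ∧ r = gradNorm v ^ 2 / qNorm q v ^ 2}

/-- The constant `b₀`: `b - λ/λ₁` if `λ ≥ 0`, and `b` if `λ < 0`. -/
def bZero (Ω : Set E3) (b lam : ℝ) : ℝ := if 0 ≤ lam then b - lam / lambda1 Ω else b

/-- The functional `J`. -/
def functionalJ {Ω : Set E3} (a b lam p : ℝ) (v : H10 Ω) : ℝ :=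
  a / 4 * gradNorm v ^ 4 + b / 2 * gradNorm v ^ 2 - lam / 2 * ‖toL2 v‖ ^ 2
    - 1 / (p + 1) * qNorm (p + 1) v ^ (p + 1)

/-- The energy of a state with position `v` and velocity `w`. -/
def energy {Ω : Set E3} (a b lam p : ℝ) (v : H10 Ω) (w : L2 Ω) : ℝ :=
  1 / 2 * ‖w‖ ^ 2 + functionalJ a b lam p v

/-- The time interval `[0, T)`, where `T ≤ ∞`. -/
def timeInterval (T : EReal) : Set ℝ := {t | 0 ≤ t ∧ (t : EReal) < T}

/-- The time derivative `u_t` in `L²(Ω)` on `[0, T)` (one-sided at `t = 0`). -/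
def velocity {Ω : Set E3} (T : EReal) (u : ℝ → H2H10 Ω) : ℝ → L2 Ω :=
  derivWithin (fun s => toL2 (toH10 (u s))) (timeInterval T)

/-- The second time derivative `u_tt` in `L²(Ω)` on `[0, T)` (one-sided at `t = 0`). -/
def acceleration {Ω : Set E3} (T : EReal) (u : ℝ → H2H10 Ω) : ℝ → L2 Ω :=
  derivWithin (velocity T u) (timeInterval T)

/-- `u ∈ H(T) = C([0,T); H² ∩ H¹₀) ∩ C¹([0,T); H¹₀) ∩ C²([0,T); L²)`. Values of `u` outside
`[0, T)` are irrelevant. -/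
structure MemHSpace {Ω : Set E3} (T : EReal) (u : ℝ → H2H10 Ω) : Prop where
  continuous_H2 : ContinuousOn u (timeInterval T)
  contDiff_H10 : ContDiffOn ℝ 1 (fun t => toH10 (u t)) (timeInterval T)
  contDiff_L2 : ContDiffOn ℝ 2 (fun t => toL2 (toH10 (u t))) (timeInterval T)

/-- `u ∈ H(T)` solves, on `[0, T) × Ω`, the problem
`u_tt - (a ∫_Ω |∇u|² dx + b) Δu = λ u + |u|^{p-1} u`, `u = 0` on `∂Ω`, `u(0) = u₀`, `u_t(0) = u₁`. -/
structure IsSolution {Ω : Set E3} (a b lam p : ℝ) (u₀ : H2H10 Ω) (u₁ : H10 Ω)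
    (T : EReal) (u : ℝ → H2H10 Ω) : Prop where
  pos : 0 < T
  memH : MemHSpace T u
  equation : ∀ t ∈ timeInterval T, 0 < t → ∀ᵐ x ∂(volume.restrict Ω),
    acceleration T u t x - (a * gradNorm (toH10 (u t)) ^ 2 + b) * laplacian (u t) x
      = lam * toL2 (toH10 (u t)) x + |toL2 (toH10 (u t)) x| ^ (p - 1) * toL2 (toH10 (u t)) x
  initial : u 0 = u₀
  initial_velocity : velocity T u 0 = toL2 u₁

/-- `u` is a solution on `[0, T)`, and `T` is the maximal existence time: no solution with the same
initial data exists on a longer interval `[0, T')`. -/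
structure IsMaximalSolution {Ω : Set E3} (a b lam p : ℝ) (u₀ : H2H10 Ω) (u₁ : H10 Ω)
    (T : EReal) (u : ℝ → H2H10 Ω) : Prop where
  isSolution : IsSolution a b lam p u₀ u₁ T u
  maximal : ∀ (T' : EReal) (v : ℝ → H2H10 Ω), IsSolution a b lam p u₀ u₁ T' v → T' ≤ T

end Kirchhoff

end

open Kirchhoff

noncomputable section

namespace Kirchhoff

open Filter
open scoped NNReal ENNReal RealInnerProductSpace

variable {Ω : Set E3}

/-! Everything rests on conservation of energy (`IsSolution.energy_eq`). Write `G = ‖∇u‖₂` and `N =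
‖u‖_{p+1}`.

(1) By Sobolev, the negative terms of the energy are at most `c G² + d G^{p+1}`. Since `p + 1 < 4`,
the Kirchhoff term `a G⁴/4` dominates them, so sublevel sets of the energy are bounded
(`exists_bound_of_energy_le`).

(2) If the energy is nonpositive, dropping the kinetic and quartic terms leaves `b₀ G²/2 ≤
N^{p+1}/(p+1)`, while `S_{p+1}^{(p+1)/2} N^{p+1} ≤ G^{p+1}`. Hence `G = 0` or `G ≥ α`, the asserted
bound (`le_gradNorm_of_energy_nonpos`). As `G` is continuous in time and starts positive, it cannot
cross the gap.

The delicate point of conservation is to differentiate `∫|u|^{p+1}` in time. Its integrand is convex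
in `u`, with subgradient a multiple of `|u|^{p-1}u`. The equation expresses this source through
`u_tt`, `Δu` and `u`, so it is continuous in time with values in `L²`. A convexity squeeze
(`hasDerivAt_of_inner_le`) then gives the derivative without any estimate of the power nonlinearity.
-/

/-! ### The spaces `H¹₀(Ω)` and `H²(Ω) ∩ H¹₀(Ω)` -/

/-- The inclusion `H¹₀(Ω) → L²(Ω)` as a continuous linear map. -/
def toL2CLM (Ω : Set E3) : H10 Ω →L[ℝ] L2 Ω :=
  (ContinuousLinearMap.fst ℝ (L2 Ω) (Fin 3 → L2 Ω)).comp (H10 Ω).subtypeL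

/-- The weak partial derivative `∂ᵢ : H¹₀(Ω) → L²(Ω)` as a continuous linear map. -/
def gradCLM (Ω : Set E3) (i : Fin 3) : H10 Ω →L[ℝ] L2 Ω :=
  ((ContinuousLinearMap.proj i).comp
    (ContinuousLinearMap.snd ℝ (L2 Ω) (Fin 3 → L2 Ω))).comp (H10 Ω).subtypeL

/-- The inclusion of `H²(Ω) ∩ H¹₀(Ω)` in `H¹₀(Ω)` is continuous. -/
theorem continuous_toH10 : Continuous (toH10 : H2H10 Ω → H10 Ω) := by
  unfold toH10
  fun_prop

theorem continuous_laplacian : Continuous (laplacian : H2H10 Ω → L2 Ω) := by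
  unfold laplacian
  fun_prop

theorem gradNorm_nonneg (v : H10 Ω) : 0 ≤ gradNorm v := Real.sqrt_nonneg _

theorem gradNorm_sq (v : H10 Ω) : gradNorm v ^ 2 = ∑ i, ‖gradCLM Ω i v‖ ^ 2 :=
  Real.sq_sqrt (Finset.sum_nonneg fun _ _ => sq_nonneg _)

theorem continuous_gradNorm : Continuous (gradNorm : H10 Ω → ℝ) := by
  have : (gradNorm : H10 Ω → ℝ) = fun v => √(∑ i, ‖gradCLM Ω i v‖ ^ 2) := rfl
  rw [this]
  fun_prop

theorem norm_gradCLM_le (v : H10 Ω) (i : Fin 3) : ‖gradCLM Ω i v‖ ≤ gradNorm v := by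
  refine Real.le_sqrt_of_sq_le ?_
  exact Finset.single_le_sum (f := fun j => ‖gradCLM Ω j v‖ ^ 2) (fun _ _ => sq_nonneg _)
    (Finset.mem_univ i)

theorem gradNorm_smul (c : ℝ) (v : H10 Ω) : gradNorm (c • v) = |c| * gradNorm v := by
  have h : gradNorm (c • v) ^ 2 = (|c| * gradNorm v) ^ 2 := by
    rw [mul_pow, gradNorm_sq, gradNorm_sq, Finset.mul_sum]
    refine Finset.sum_congr rfl fun i _ => ?_
    rw [map_smul, norm_smul, mul_pow, Real.norm_eq_abs]
  exact (sq_eq_sq₀ (gradNorm_nonneg _) (mul_nonneg (abs_nonneg _) (gradNorm_nonneg _))).1 h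

/-! ### Sobolev embedding of `H¹₀(Ω)` in `L^q(Ω)` for `q ≤ 6`, and Green's formula. -/

theorem norm_fderiv_le_sum_partialDeriv (φ : E3 → ℝ) (x : E3) :
    ‖fderiv ℝ φ x‖ ≤ ∑ i, ‖partialDeriv i φ x‖ := by
  refine ContinuousLinearMap.opNorm_le_bound _ (Finset.sum_nonneg fun _ _ => norm_nonneg _)
    fun y => ?_
  have hy : y = ∑ i, y i • EuclideanSpace.single i (1 : ℝ) := by
    ext j
    simp [Finset.sum_apply, Pi.single_apply]
  have h1 : fderiv ℝ φ x y = ∑ i, y i * partialDeriv i φ x := by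
    conv_lhs => rw [hy]
    simp [map_sum, partialDeriv]
  rw [h1, Finset.sum_mul]
  refine (norm_sum_le _ _).trans (Finset.sum_le_sum fun i _ => ?_)
  rw [norm_mul, mul_comm]
  exact mul_le_mul_of_nonneg_left (PiLp.norm_apply_le y i) (norm_nonneg _)

theorem IsTestFunction.continuous_partialDeriv {φ : E3 → ℝ} (hφ : IsTestFunction Ω φ)
    (i : Fin 3) : Continuous (partialDeriv i φ) :=
  (hφ.smooth.continuous_fderiv (by simp)).clm_apply continuous_const

theorem IsTestFunction.support_partialDeriv_subset {φ : E3 → ℝ} (hφ : IsTestFunction Ω φ)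
    (i : Fin 3) : Function.support (partialDeriv i φ) ⊆ Ω := by
  intro x hx
  refine hφ.tsupport_subset (support_fderiv_subset ℝ ?_)
  rw [Function.mem_support] at hx ⊢
  intro h
  exact hx (by simp [partialDeriv, h])

/-- The Sobolev inequality for `C_c^∞(Ω)`. -/
theorem exists_sobolev_testFunction (hb : Bornology.IsBounded Ω) {q : ℝ≥0} (h0 : 0 < q)
    (hq : q ≤ 6) : ∃ C : ℝ≥0, ∀ φ : E3 → ℝ, IsTestFunction Ω φ →
      eLpNorm φ q (volume.restrict Ω)
        ≤ C * ∑ i, eLpNorm (partialDeriv i φ) 2 (volume.restrict Ω) := by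
  refine ⟨eLpNormLESNormFDerivOfLeConst ℝ (volume : Measure E3) Ω 2 q, fun φ hφ => ?_⟩
  have hsob := eLpNorm_le_eLpNorm_fderiv_of_le (F := ℝ) (volume : Measure E3) (u := φ) (s := Ω)
    (hφ.smooth.of_le (by simp)) ((subset_tsupport φ).trans hφ.tsupport_subset) (p := 2) (q := q)
    (by norm_num) (by rw [finrank_euclideanSpace]; norm_num) (by
      -- The critical exponent in dimension three is 6, because `1/6 = 1/2 - 1/3`.
      have : (6 : ℝ)⁻¹ ≤ (q : ℝ)⁻¹ := inv_anti₀ (by exact_mod_cast h0) (by exact_mod_cast hq)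
      rw [finrank_euclideanSpace]
      norm_num at this ⊢
      linarith) hb
  refine (eLpNorm_mono_measure _ Measure.restrict_le_self).trans (hsob.trans ?_)
  gcongr
  have h1 : eLpNorm (fderiv ℝ φ) 2 volume
      ≤ eLpNorm (∑ i, fun x => ‖partialDeriv i φ x‖) 2 volume := by
    refine eLpNorm_mono_real fun x => ?_
    simpa using norm_fderiv_le_sum_partialDeriv φ x
  refine h1.trans ((eLpNorm_sum_le
    (fun i _ => (hφ.continuous_partialDeriv i).norm.aestronglyMeasurable) (by norm_num)).trans ?_)
  refine Finset.sum_le_sum fun i _ => ?_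
  rw [eLpNorm_norm, eLpNorm_restrict_eq_of_support_subset (hφ.support_partialDeriv_subset i)]

/-- The Sobolev inequality for `H¹₀(Ω)`. -/
theorem exists_sobolev (hb : Bornology.IsBounded Ω) {q : ℝ≥0} (h0 : 0 < q) (hq : q ≤ 6) :
    ∃ C : ℝ≥0, ∀ v : H10 Ω,
      eLpNorm (toL2 v) q (volume.restrict Ω) ≤ C * ENNReal.ofReal (gradNorm v) := by
  obtain ⟨C, hC⟩ := exists_sobolev_testFunction hb h0 hq
  have key : ∀ v : H10 Ω, eLpNorm (toL2 v) q (volume.restrict Ω)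
      ≤ C * ∑ i, ‖gradCLM Ω i v‖ₑ := by
    intro v
    have hv : (v : Jet1 Ω) ∈ closure (testJets Ω : Set (Jet1 Ω)) := v.2
    obtain ⟨w, hw, hlim⟩ := mem_closure_iff_seq_limit.1 hv
    -- `L²` convergence gives an a.e. convergent subsequence, and Fatou's lemma carries the bound to
    -- the limit. That `v` lies in `L^q` is thus a conclusion.
    have hmeas : TendstoInMeasure (volume.restrict Ω) (fun n => ⇑(w n).1) atTop v.1.1 :=
      tendstoInMeasure_of_tendsto_Lp ((continuous_fst.tendsto _).comp hlim)
    obtain ⟨ns, hns, hae⟩ := hmeas.exists_seq_tendsto_ae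
    refine (Lp.eLpNorm_lim_le_liminf_eLpNorm
      (fun n => Lp.aestronglyMeasurable (w (ns n)).1) _ hae).trans ?_
    have hbound : ∀ n, eLpNorm (w (ns n)).1 q (volume.restrict Ω)
        ≤ C * ∑ i, ‖(w (ns n)).2 i‖ₑ := by
      intro n
      obtain ⟨φ, hφ, e1, e2⟩ := hw (ns n)
      rw [eLpNorm_congr_ae e1]
      refine (hC φ hφ).trans_eq ?_
      congr 1
      refine Finset.sum_congr rfl fun i _ => ?_
      rw [Lp.enorm_def, eLpNorm_congr_ae (e2 i)]
    have hcont : Tendsto (fun n => (C : ℝ≥0∞) * ∑ i, ‖(w (ns n)).2 i‖ₑ) atTop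
        (𝓝 (C * ∑ i, ‖v.1.2 i‖ₑ)) := by
      refine ENNReal.Tendsto.const_mul ?_ (Or.inr ENNReal.coe_ne_top)
      refine tendsto_finsetSum _ fun i _ => ?_
      exact (((continuous_apply i).comp continuous_snd).enorm.tendsto _).comp
        (hlim.comp hns.tendsto_atTop)
    exact (liminf_le_liminf (Eventually.of_forall hbound)).trans_eq hcont.liminf_eq
  -- Each of the three partial derivatives has norm at most `gradNorm v`.
  refine ⟨C * 3, fun v => (key v).trans ?_⟩
  rw [ENNReal.coe_mul, mul_assoc]
  gcongr
  calc ∑ i, ‖gradCLM Ω i v‖ₑ ≤ ∑ _i : Fin 3, ENNReal.ofReal (gradNorm v) := by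
        refine Finset.sum_le_sum fun i _ => ?_
        rw [← ofReal_norm]
        exact ENNReal.ofReal_le_ofReal (norm_gradCLM_le v i)
    _ = ((3 : ℝ≥0) : ℝ≥0∞) * ENNReal.ofReal (gradNorm v) := by simp

theorem memLp_toL2 (hb : Bornology.IsBounded Ω) {q : ℝ} (h0 : 0 < q) (hq : q ≤ 6) (v : H10 Ω) :
    MemLp (toL2 v) (ENNReal.ofReal q) (volume.restrict Ω) := by
  obtain ⟨C, hC⟩ := exists_sobolev hb (q := q.toNNReal) (by simpa using h0) (by simpa using hq)
  exact ⟨Lp.aestronglyMeasurable _, (hC v).trans_lt (by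
    exact ENNReal.mul_lt_top ENNReal.coe_lt_top ENNReal.ofReal_lt_top)⟩

theorem exists_qNorm_le (hb : Bornology.IsBounded Ω) {q : ℝ} (h0 : 0 < q) (hq : q ≤ 6) :
    ∃ C : ℝ, 0 ≤ C ∧ ∀ v : H10 Ω, qNorm q v ≤ C * gradNorm v := by
  obtain ⟨C, hC⟩ := exists_sobolev hb (q := q.toNNReal) (by simpa using h0) (by simpa using hq)
  refine ⟨C, C.2, fun v => ?_⟩
  have := ENNReal.toReal_mono (ENNReal.mul_lt_top ENNReal.coe_lt_top ENNReal.ofReal_lt_top).ne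
    (hC v)
  rwa [ENNReal.toReal_mul, ENNReal.toReal_ofReal (gradNorm_nonneg v)] at this

theorem norm_toL2_eq_qNorm (v : H10 Ω) : ‖toL2 v‖ = qNorm 2 v := by
  rw [Lp.norm_def, qNorm]
  simp

theorem qNorm_nonneg (q : ℝ) (v : H10 Ω) : 0 ≤ qNorm q v := ENNReal.toReal_nonneg

/-- By Sobolev the inclusion of `H¹₀(Ω)` in `L^q(Ω)` is a bounded linear map; `qNorm q` is the norm
composed with it. -/
theorem continuous_qNorm (hb : Bornology.IsBounded Ω) {q : ℝ} (h1 : 1 ≤ q) (hq : q ≤ 6) :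
    Continuous (qNorm q : H10 Ω → ℝ) := by
  have h0 : 0 < q := by linarith
  have : Fact (1 ≤ ENNReal.ofReal q) := ⟨by simpa using h1⟩
  let ι : H10 Ω →ₗ[ℝ] Lp ℝ (ENNReal.ofReal q) (volume.restrict Ω) :=
    { toFun := fun v => (memLp_toL2 hb h0 hq v).toLp
      map_add' := fun v w => by
        rw [← MemLp.toLp_add]
        exact MemLp.toLp_congr _ _ (Lp.coeFn_add v.1.1 w.1.1)
      map_smul' := fun c v => by
        rw [RingHom.id_apply, ← MemLp.toLp_const_smul]
        exact MemLp.toLp_congr _ _ (Lp.coeFn_smul c v.1.1) }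
  have hι : ∀ v, ‖ι v‖ = qNorm q v := fun v => Lp.norm_toLp _ (memLp_toL2 hb h0 hq v)
  obtain ⟨C, -, hC⟩ := exists_qNorm_le hb h0 hq
  have hι_cont : Continuous ι := by
    refine continuous_of_continuousAt_zero ι.toAddMonoidHom ?_
    refine tendsto_zero_iff_norm_tendsto_zero.2 ?_ |>.trans (by simp)
    have hg : Tendsto (fun v : H10 Ω => C * gradNorm v) (𝓝 0) (𝓝 0) := by
      have := (continuous_gradNorm (Ω := Ω)).tendsto 0
      have h00 : gradNorm (0 : H10 Ω) = 0 := by simpa using gradNorm_smul 0 (0 : H10 Ω)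
      simpa [h00] using this.const_mul C
    exact squeeze_zero (fun _ => norm_nonneg _) (fun v => (hι v).trans_le (hC v)) hg
  exact hι_cont.norm.congr hι

/-- Green's formula `∫ ∇v · ∇w = -∫ Δv w` for `v ∈ H²(Ω) ∩ H¹₀(Ω)` and `w ∈ H¹₀(Ω)`. -/
theorem sum_inner_grad (v : H2H10 Ω) (w : H10 Ω) :
    ∑ i, ⟪gradCLM Ω i (toH10 v), gradCLM Ω i w⟫ = -⟪laplacian v, toL2 w⟫ := by
  -- Both sides are continuous in `w` for the `H¹` norm, so test functions suffice. For them the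
  -- identity is the definition of the weak derivatives `∂ᵢ(∂ᵢv)`.
  have hclosed : IsClosed {w : Jet1 Ω | ∑ i, ⟪v.1.2.1 i, w.2 i⟫ = -⟪laplacian v, w.1⟫} :=
    isClosed_eq (by fun_prop) (by fun_prop)
  refine closure_minimal (s := (testJets Ω : Set (Jet1 Ω))) ?_ hclosed w.2
  rintro z ⟨φ, hφ, h1, h2⟩
  simp only [mem_ofPred_eq, laplacian, sum_inner, ← Finset.sum_neg_distrib]
  refine Finset.sum_congr rfl fun i _ => ?_
  have e := v.2.1.2 i i φ hφ
  rw [L2.inner_def, L2.inner_def]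
  calc ∫ x in Ω, ⟪v.1.2.1 i x, z.2 i x⟫ = ∫ x in Ω, v.1.2.1 i x * partialDeriv i φ x :=
        integral_congr_ae (by
          filter_upwards [h2 i] with x hx
          simp [hx, mul_comm])
    _ = -∫ x in Ω, v.1.2.2 i i x * φ x := e
    _ = -∫ x in Ω, ⟪v.1.2.2 i i x, z.1 x⟫ := by
        congr 1
        refine integral_congr_ae ?_
        filter_upwards [h1] with x hx
        simp [hx, mul_comm]

variable {T : EReal} {a b lam p : ℝ} {u₀ : H2H10 Ω} {u₁ : H10 Ω} {u : ℝ → H2H10 Ω}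

/-! ### The functional `∫ |v|^{p+1}` -/

/-- Convexity of `|·|^{p+1}`: the graph lies above its tangent at `r`. This is Young's inequality
for `|r|^p |s|` with exponents `(p+1)/p` and `p+1`. -/
theorem add_rpow_mul_sub_le_abs_rpow (hp : 0 < p) (r s : ℝ) :
    |r| ^ (p + 1) + (p + 1) * (|r| ^ (p - 1) * r * (s - r)) ≤ |s| ^ (p + 1) := by
  have hq : ((p + 1) / p).HolderConjugate (p + 1) := by
    rw [Real.holderConjugate_iff]
    refine ⟨by rw [lt_div_iff₀ hp]; linarith, ?_⟩
    field_simp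
  have hy := Real.young_inequality_of_nonneg (Real.rpow_nonneg (abs_nonneg r) p) (abs_nonneg s) hq
  rw [← Real.rpow_mul (abs_nonneg r), mul_div_cancel₀ _ hp.ne'] at hy
  have e1 : |r| ^ (p - 1) * r * r = |r| ^ (p + 1) := by
    rw [mul_assoc, ← abs_mul_abs_self r]
    rcases (abs_nonneg r).eq_or_lt with h | h
    · rw [← h, Real.zero_rpow (by linarith : p + 1 ≠ 0)]
      simp
    · rw [Real.rpow_sub_one h.ne', Real.rpow_add_one h.ne']
      field_simp
  have e2 : |r| ^ (p - 1) * r * s ≤ |r| ^ p * |s| := by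
    refine (le_abs_self _).trans_eq ?_
    rw [abs_mul, abs_mul, abs_of_nonneg (Real.rpow_nonneg (abs_nonneg r) _)]
    congr 1
    rcases (abs_nonneg r).eq_or_lt with h | h
    · rw [← h, Real.zero_rpow hp.ne', mul_zero]
    · rw [Real.rpow_sub_one h.ne']
      field_simp
  have e3 : (p + 1) * (|r| ^ p * |s|) ≤ p * |r| ^ (p + 1) + |s| ^ (p + 1) := by
    refine (mul_le_mul_of_nonneg_left hy (by linarith)).trans_eq ?_
    field_simp
  have e4 := mul_le_mul_of_nonneg_left e2 (by linarith : 0 ≤ p + 1)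
  have : (p + 1) * (|r| ^ (p - 1) * r * (s - r))
      = (p + 1) * (|r| ^ (p - 1) * r * s) - (p + 1) * |r| ^ (p + 1) := by
    rw [← e1]; ring
  linarith

theorem qNorm_rpow (hb : Bornology.IsBounded Ω) {q : ℝ} (h0 : 0 < q) (hq : q ≤ 6) (v : H10 Ω) :
    qNorm q v ^ q = ∫ x in Ω, |toL2 v x| ^ q := by
  have hI : 0 ≤ ∫ x in Ω, |toL2 v x| ^ q :=
    integral_nonneg fun x => Real.rpow_nonneg (abs_nonneg _) _
  rw [qNorm, (memLp_toL2 hb h0 hq v).eLpNorm_eq_integral_rpow_norm (by simpa using h0)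
    ENNReal.ofReal_ne_top, ENNReal.toReal_ofReal h0.le]
  simp only [Real.norm_eq_abs]
  rw [ENNReal.toReal_ofReal (Real.rpow_nonneg hI _), Real.rpow_inv_rpow hI h0.ne']

theorem integrable_abs_rpow (hb : Bornology.IsBounded Ω) {q : ℝ} (h0 : 0 < q) (hq : q ≤ 6)
    (v : H10 Ω) : Integrable (fun x => |toL2 v x| ^ q) (volume.restrict Ω) := by
  have := (memLp_toL2 hb h0 hq v).integrable_norm_rpow (by simpa using h0) ENNReal.ofReal_ne_top
  simpa [ENNReal.toReal_ofReal h0.le] using this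

/-- The tangent inequality integrated over `Ω`. Taking `g` as an element of `L2 Ω` leaves it to the
equation to supply the square integrability of `|v|^{p-1}v`. -/
theorem qNorm_rpow_add_inner_le (hb : Bornology.IsBounded Ω) (h0 : 0 < p) (hp : p + 1 ≤ 6)
    (v w : H10 Ω) {g : L2 Ω}
    (hg : ∀ᵐ x ∂(volume.restrict Ω), g x = |toL2 v x| ^ (p - 1) * toL2 v x) :
    qNorm (p + 1) v ^ (p + 1) + (p + 1) * ⟪g, toL2 w - toL2 v⟫ ≤ qNorm (p + 1) w ^ (p + 1) := by
  have h1 : 0 < p + 1 := by linarith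
  rw [qNorm_rpow hb h1 hp, qNorm_rpow hb h1 hp, L2.inner_def, ← integral_const_mul,
    ← integral_add (integrable_abs_rpow hb h1 hp v)
      ((L2.integrable_inner g (toL2 w - toL2 v)).const_mul _)]
  refine integral_mono_ae ((integrable_abs_rpow hb h1 hp v).add
      ((L2.integrable_inner g (toL2 w - toL2 v)).const_mul _))
    (integrable_abs_rpow hb h1 hp w) ?_
  filter_upwards [hg, Lp.coeFn_sub (toL2 w) (toL2 v)] with x hx hs
  have := add_rpow_mul_sub_le_abs_rpow h0 (toL2 v x) (toL2 w x)
  simp only [hx, hs, Pi.sub_apply, RCLike.inner_apply, conj_trivial]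
  linarith

/-- With subgradients at both `t` and `s`, the error of the linear approximation lies between 0 and
`⟪g s - g t, x s - x t⟫`. This is `o(1) · O(s - t)`, since `g` is continuous and `x` differentiable
at `t`. -/
theorem hasDerivAt_of_inner_le {E : Type*} [NormedAddCommGroup E] [InnerProductSpace ℝ E]
    {ψ : ℝ → ℝ} {x g : ℝ → E} {x' : E} {t : ℝ} (hx : HasDerivAt x x' t) (hg : ContinuousAt g t)
    (hl : ∀ᶠ s in 𝓝 t, ⟪g t, x s - x t⟫ ≤ ψ s - ψ t)
    (hr : ∀ᶠ s in 𝓝 t, ψ s - ψ t ≤ ⟪g s, x s - x t⟫) : HasDerivAt ψ ⟪g t, x'⟫ t := by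
  have hlin : HasDerivAt (fun s => ⟪g t, x s⟫) ⟪g t, x'⟫ t := by
    simpa using (hasDerivAt_const t (g t)).inner ℝ hx
  have hsmall : (fun s => ψ s - ψ t - ⟪g t, x s - x t⟫) =o[𝓝 t] fun s => s - t := by
    have h1 : (fun s => g s - g t) =o[𝓝 t] fun _ => (1 : ℝ) := by
      rw [Asymptotics.isLittleO_one_iff]
      simpa using hg.tendsto.sub_const (g t)
    have h2 : (fun s => ‖g s - g t‖ * ‖x s - x t‖) =o[𝓝 t] fun s => 1 * (s - t) :=
      h1.norm_left.mul_isBigO hx.isBigO_sub.norm_left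
    simp only [one_mul] at h2
    refine Asymptotics.IsBigO.trans_isLittleO (Asymptotics.IsBigO.of_bound 1 ?_) h2
    filter_upwards [hl, hr] with s h3 h4
    rw [one_mul, Real.norm_of_nonneg (by linarith), Real.norm_of_nonneg (by positivity)]
    refine le_trans ?_ (real_inner_le_norm _ _)
    rw [inner_sub_left]
    linarith
  rw [hasDerivAt_iff_isLittleO] at hlin ⊢
  refine (hsmall.add hlin).congr_left fun s => ?_
  simp only [inner_sub_right]
  ring

/-! ### Time intervals -/

theorem ordConnected_timeInterval (T : EReal) : (timeInterval T).OrdConnected :=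
  ⟨fun _ hx _ hy _ hz => ⟨hx.1.trans hz.1, (EReal.coe_le_coe_iff.2 hz.2).trans_lt hy.2⟩⟩

theorem timeInterval_mem_nhds {t : ℝ} (ht : t ∈ timeInterval T) (h0 : 0 < t) :
    timeInterval T ∈ 𝓝 t := by
  have h1 : ∀ᶠ s : ℝ in 𝓝 t, (s : EReal) < T :=
    continuous_coe_real_ereal.continuousAt.eventually_lt continuousAt_const ht.2
  filter_upwards [h1, lt_mem_nhds h0] with s hs hs0 using ⟨hs0.le, hs⟩

theorem uniqueDiffOn_timeInterval (hT : 0 < T) : UniqueDiffOn ℝ (timeInterval T) := by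
  refine uniqueDiffOn_convex (ordConnected_timeInterval T).convex ?_
  obtain ⟨r, h0, hr⟩ := EReal.lt_iff_exists_real_btwn.1 hT
  have h0' : 0 < r := by exact_mod_cast h0
  exact ⟨r, mem_interior_iff_mem_nhds.2 (timeInterval_mem_nhds ⟨h0'.le, hr⟩ h0')⟩

theorem zero_mem_timeInterval (hT : 0 < T) : (0 : ℝ) ∈ timeInterval T := ⟨le_rfl, by simpa using hT⟩

/-! ### Conservation of energy -/

theorem continuousOn_velocity (hT : 0 < T) (hu : MemHSpace T u) :
    ContinuousOn (velocity T u) (timeInterval T) :=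
  hu.contDiff_L2.continuousOn_derivWithin (uniqueDiffOn_timeInterval hT) (by norm_num)

theorem contDiffOn_velocity (hT : 0 < T) (hu : MemHSpace T u) :
    ContDiffOn ℝ 1 (velocity T u) (timeInterval T) :=
  hu.contDiff_L2.derivWithin (uniqueDiffOn_timeInterval hT) (by norm_num)

theorem continuousOn_acceleration (hT : 0 < T) (hu : MemHSpace T u) :
    ContinuousOn (acceleration T u) (timeInterval T) :=
  (contDiffOn_velocity hT hu).continuousOn_derivWithin (uniqueDiffOn_timeInterval hT) le_rfl

theorem hasDerivAt_velocity (hT : 0 < T) (hu : MemHSpace T u) {t : ℝ} (ht : t ∈ timeInterval T)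
    (h0 : 0 < t) : HasDerivAt (velocity T u) (acceleration T u t) t :=
  (((contDiffOn_velocity hT hu).differentiableOn (by norm_num)) t ht).hasDerivWithinAt.hasDerivAt
    (timeInterval_mem_nhds ht h0)

/-- The `L²` derivative is the image of the `H¹₀` derivative, which makes `u_t` admissible in
Green's formula. -/
theorem exists_hasDerivAt_toH10 (hu : MemHSpace T u) {t : ℝ}
    (ht : t ∈ timeInterval T) (h0 : 0 < t) :
    ∃ w : H10 Ω, HasDerivAt (fun s => toH10 (u s)) w t ∧ velocity T u t = toL2 w := by
  have hn := timeInterval_mem_nhds ht h0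
  have h1 := ((hu.contDiff_H10.differentiableOn (by norm_num)) t ht).hasDerivWithinAt.hasDerivAt hn
  refine ⟨_, h1, ?_⟩
  have h2 := (toL2CLM Ω).hasFDerivAt.comp_hasDerivAt t h1
  rw [velocity, derivWithin_of_mem_nhds hn]
  exact h2.deriv

/-- The nonlinearity `|u|^{p-1} u`, as given by the equation. -/
def sourceTerm (a b lam : ℝ) (T : EReal) (u : ℝ → H2H10 Ω) (t : ℝ) : L2 Ω :=
  acceleration T u t - (a * gradNorm (toH10 (u t)) ^ 2 + b) • laplacian (u t)
    - lam • toL2 (toH10 (u t))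

theorem IsSolution.sourceTerm_ae_eq (hu : IsSolution a b lam p u₀ u₁ T u) {t : ℝ}
    (ht : t ∈ timeInterval T) (h0 : 0 < t) : ∀ᵐ x ∂(volume.restrict Ω),
    sourceTerm a b lam T u t x = |toL2 (toH10 (u t)) x| ^ (p - 1) * toL2 (toH10 (u t)) x := by
  filter_upwards [hu.equation t ht h0,
    Lp.coeFn_sub (acceleration T u t - (a * gradNorm (toH10 (u t)) ^ 2 + b) • laplacian (u t))
      (lam • toL2 (toH10 (u t))),
    Lp.coeFn_sub (acceleration T u t) ((a * gradNorm (toH10 (u t)) ^ 2 + b) • laplacian (u t)),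
    Lp.coeFn_smul (a * gradNorm (toH10 (u t)) ^ 2 + b) (laplacian (u t)),
    Lp.coeFn_smul lam (toL2 (toH10 (u t)))] with x h1 h2 h3 h4 h5
  rw [sourceTerm, h2, Pi.sub_apply, h3, Pi.sub_apply, h4, h5, Pi.smul_apply, Pi.smul_apply,
    smul_eq_mul, smul_eq_mul]
  linarith

/-- Continuity is read off from the terms of the equation, with no estimate of `|u|^{p-1}u`. -/
theorem continuousOn_sourceTerm (hT : 0 < T) (hu : MemHSpace T u) :
    ContinuousOn (sourceTerm a b lam T u) (timeInterval T) := by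
  have h1 := continuous_toH10.comp_continuousOn hu.continuous_H2
  have h2 := continuous_laplacian.comp_continuousOn hu.continuous_H2
  have h3 := (toL2CLM Ω).continuous.comp_continuousOn h1
  have h4 := continuous_gradNorm.comp_continuousOn h1
  exact ((continuousOn_acceleration hT hu).sub
    (((continuousOn_const.mul (h4.pow 2)).add continuousOn_const).smul h2)).sub
    (h3.const_smul lam)

theorem IsSolution.hasDerivAt_qNorm_rpow (hb : Bornology.IsBounded Ω) (hp0 : 0 < p)
    (hp : p + 1 ≤ 6) (hu : IsSolution a b lam p u₀ u₁ T u) {t : ℝ}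
    (ht : t ∈ timeInterval T) (h0 : 0 < t) :
    HasDerivAt (fun s => 1 / (p + 1) * qNorm (p + 1) (toH10 (u s)) ^ (p + 1))
      ⟪sourceTerm a b lam T u t, velocity T u t⟫ t := by
  have hn := timeInterval_mem_nhds ht h0
  obtain ⟨w, hw, hv⟩ := exists_hasDerivAt_toH10 hu.memH ht h0
  have hp1 : 0 < p + 1 := by linarith
  have hx : HasDerivAt (fun s => toL2 (toH10 (u s))) (velocity T u t) t := by
    rw [hv]
    exact (toL2CLM Ω).hasFDerivAt.comp_hasDerivAt t hw
  have key : ∀ {s r : ℝ}, s ∈ timeInterval T → 0 < s →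
      ⟪sourceTerm a b lam T u s, toL2 (toH10 (u r)) - toL2 (toH10 (u s))⟫
        ≤ 1 / (p + 1) * qNorm (p + 1) (toH10 (u r)) ^ (p + 1)
          - 1 / (p + 1) * qNorm (p + 1) (toH10 (u s)) ^ (p + 1) := by
    intro s r hs hs0
    have := qNorm_rpow_add_inner_le hb hp0 hp (toH10 (u s)) (toH10 (u r))
      (hu.sourceTerm_ae_eq hs hs0)
    rw [← mul_sub, one_div, inv_mul_eq_div, le_div_iff₀ hp1]
    linarith
  refine hasDerivAt_of_inner_le hx ((continuousOn_sourceTerm hu.pos hu.memH).continuousAt hn)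
    (Eventually.of_forall fun s => key ht h0) ?_
  filter_upwards [hn, lt_mem_nhds h0] with s hs hs0
  have := key (r := t) hs hs0
  rw [← neg_sub (toL2 (toH10 (u s))), inner_neg_right] at this
  linarith

theorem IsSolution.hasDerivAt_energy (hb : Bornology.IsBounded Ω) (hp0 : 0 < p)
    (hp : p + 1 ≤ 6) (hu : IsSolution a b lam p u₀ u₁ T u) {t : ℝ}
    (ht : t ∈ timeInterval T) (h0 : 0 < t) :
    HasDerivAt (fun s => energy a b lam p (toH10 (u s)) (velocity T u s)) 0 t := by
  obtain ⟨w, hw, hv⟩ := exists_hasDerivAt_toH10 hu.memH ht h0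
  have hq := hu.hasDerivAt_qNorm_rpow hb hp0 hp ht h0
  have hx : HasDerivAt (fun s => toL2 (toH10 (u s))) (velocity T u t) t := by
    rw [hv]
    exact (toL2CLM Ω).hasFDerivAt.comp_hasDerivAt t hw
  have hgrad : HasDerivAt (fun s => gradNorm (toH10 (u s)) ^ 2)
      (2 * -⟪laplacian (u t), velocity T u t⟫) t := by
    simp only [gradNorm_sq]
    rw [hv, ← sum_inner_grad, Finset.mul_sum]
    exact HasDerivAt.fun_sum fun i _ =>
      ((gradCLM Ω i).hasFDerivAt.comp_hasDerivAt t hw).norm_sq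
  have hvel := (hasDerivAt_velocity hu.pos hu.memH ht h0).norm_sq
  -- The squared norm is differentiable even where the gradient vanishes, so the quartic term is
  -- treated as its square.
  have h4 : ∀ s, gradNorm (toH10 (u s)) ^ 4 = (gradNorm (toH10 (u s)) ^ 2) ^ 2 := fun s => by ring
  simp only [energy, functionalJ, h4]
  refine ((hvel.const_mul (1 / 2)).add (((((hgrad.pow 2).const_mul (a / 4)).add
    (hgrad.const_mul (b / 2))).sub (hx.norm_sq.const_mul (lam / 2))).sub hq)).congr_deriv ?_
  -- Unfolding the source as `u_tt - (a‖∇u‖² + b)Δu - λu` makes all terms cancel: this is the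
  -- equation tested with `u_t`.
  rw [sourceTerm]
  simp only [inner_sub_left, real_inner_smul_left]
  rw [real_inner_comm (velocity T u t) (acceleration T u t)]
  push_cast
  ring

theorem IsSolution.continuousOn_energy (hb : Bornology.IsBounded Ω) (hp0 : 0 < p)
    (hp : p + 1 ≤ 6) (hu : IsSolution a b lam p u₀ u₁ T u) :
    ContinuousOn (fun s => energy a b lam p (toH10 (u s)) (velocity T u s)) (timeInterval T) := by
  have h1 := continuous_toH10.comp_continuousOn hu.memH.continuous_H2
  have h2 := (toL2CLM Ω).continuous.comp_continuousOn h1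
  have h3 := continuous_gradNorm.comp_continuousOn h1
  have h4 := (continuous_qNorm hb (q := p + 1) (by linarith) hp).comp_continuousOn h1
  have h5 := continuousOn_velocity hu.pos hu.memH
  exact (continuousOn_const.mul (h5.norm.pow 2)).add ((((continuousOn_const.mul (h3.pow 4)).add
    (continuousOn_const.mul (h3.pow 2))).sub (continuousOn_const.mul (h2.norm.pow 2))).sub
    (continuousOn_const.mul (h4.rpow_const fun _ _ => Or.inr (by linarith))))

/-- The energy of a solution is conserved. -/
theorem IsSolution.energy_eq (hb : Bornology.IsBounded Ω) (hp0 : 0 < p)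
    (hp : p + 1 ≤ 6) (hu : IsSolution a b lam p u₀ u₁ T u) {t : ℝ} (ht : t ∈ timeInterval T) :
    energy a b lam p (toH10 (u t)) (velocity T u t)
      = energy a b lam p (toH10 u₀) (toL2 u₁) := by
  have h0 := zero_mem_timeInterval hu.pos
  rw [← hu.initial, ← hu.initial_velocity]
  rcases ht.1.eq_or_lt with rfl | hpos
  · rfl
  have hsub : Icc 0 t ⊆ timeInterval T := (ordConnected_timeInterval T).out h0 ht
  -- The mean value theorem needs the derivative only in the open interval, so continuity is enough
  -- at time 0, where the equation is not imposed.
  obtain ⟨c, -, hc⟩ := exists_hasDerivAt_eq_slope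
    (fun s => energy a b lam p (toH10 (u s)) (velocity T u s)) (fun _ => 0) hpos
    ((hu.continuousOn_energy hb hp0 hp).mono hsub)
    fun s hs => hu.hasDerivAt_energy hb hp0 hp (hsub (Ioo_subset_Icc_self hs)) hs.1
  rw [eq_comm, div_eq_zero_iff] at hc
  rcases hc with hc | hc <;> linarith

/-! ### Bounds by the energy -/

/-- After division by `x⁴` the right side has only negative powers of `x` and tends to 0, so it is
below `a` for large `x`. -/
theorem exists_bound_of_quartic_le (ha : 0 < a) {q : ℝ} (hq : q < 4) (e c d : ℝ) :
    ∃ R : ℝ, 0 ≤ R ∧ ∀ x : ℝ, a * x ^ 4 ≤ e + c * x ^ 2 + d * x ^ q → x ≤ R := by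
  have hlim : Tendsto (fun x : ℝ => e * x ^ (-4 : ℝ) + c * x ^ (-2 : ℝ) + d * x ^ (-(4 - q)))
      atTop (𝓝 0) := by
    have h1 := (tendsto_rpow_neg_atTop (by norm_num : (0 : ℝ) < 4)).const_mul e
    have h2 := (tendsto_rpow_neg_atTop (by norm_num : (0 : ℝ) < 2)).const_mul c
    have h3 := (tendsto_rpow_neg_atTop (by linarith : 0 < 4 - q)).const_mul d
    simpa using (h1.add h2).add h3
  obtain ⟨R, hR⟩ := eventually_atTop.1 (hlim.eventually (gt_mem_nhds ha))
  -- The maximum with 1 keeps `x` positive in the contradiction, as the real powers require.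
  refine ⟨max R 1, by positivity, fun x hx => ?_⟩
  by_contra! hlt
  have hx0 : 0 < x := zero_lt_one.trans ((le_max_right _ _).trans_lt hlt)
  have h := mul_lt_mul_of_pos_right (hR x ((le_max_left _ _).trans hlt.le)) (pow_pos hx0 4)
  have e4 : x ^ (-4 : ℝ) * x ^ 4 = 1 := by
    rw [← Real.rpow_natCast x 4, ← Real.rpow_add hx0]; norm_num
  have e2 : x ^ (-2 : ℝ) * x ^ 4 = x ^ 2 := by
    rw [← Real.rpow_natCast x 4, ← Real.rpow_natCast x 2, ← Real.rpow_add hx0]; norm_num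
  have eq : x ^ (-(4 - q)) * x ^ 4 = x ^ q := by
    rw [← Real.rpow_natCast x 4, ← Real.rpow_add hx0]; norm_num
  rw [add_mul, add_mul, mul_assoc, mul_assoc, mul_assoc, e4, e2, eq] at h
  linarith

/-- Sublevel sets of the energy are bounded in `H¹₀(Ω) × L²(Ω)`. -/
theorem exists_bound_of_energy_le (hbd : Bornology.IsBounded Ω) (hp0 : 0 < p) (hp3 : p < 3)
    (ha : 0 < a) (hb : 0 < b) (lam e : ℝ) : ∃ K : ℝ, 0 < K ∧ ∀ (v : H10 Ω) (w : L2 Ω),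
      energy a b lam p v w ≤ e → ‖w‖ + gradNorm v ≤ K := by
  obtain ⟨C, hC0, hC⟩ := exists_qNorm_le hbd (q := 2) (by norm_num) (by norm_num)
  obtain ⟨D, hD0, hD⟩ := exists_qNorm_le hbd (q := p + 1) (by linarith) (by linarith)
  set c := |lam| / 2 * C ^ 2 with hc
  set d := 1 / (p + 1) * D ^ (p + 1) with hd
  have hp1 : 0 < p + 1 := by linarith
  have hd0 : 0 ≤ d := by positivity
  have hc0 : 0 ≤ c := by positivity
  -- Here `p < 3` enters, as `p + 1 < 4`.
  obtain ⟨R, hR0, hR⟩ := exists_bound_of_quartic_le (a := a / 4) (by positivity)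
    (q := p + 1) (by linarith) e c d
  -- The root bounds `‖w‖` through the kinetic term once the gradient is at most `R`; the 1 makes
  -- the constant positive.
  refine ⟨√(2 * (|e| + c * R ^ 2 + d * R ^ (p + 1))) + R + 1, by positivity, fun v w hE => ?_⟩
  have hG := gradNorm_nonneg v
  have h1 : lam / 2 * ‖toL2 v‖ ^ 2 ≤ c * gradNorm v ^ 2 := by
    rw [hc, mul_assoc, ← mul_pow]
    have := hC v
    rw [← norm_toL2_eq_qNorm] at this
    gcongr
    exact le_abs_self lam
  have h2 : 1 / (p + 1) * qNorm (p + 1) v ^ (p + 1) ≤ d * gradNorm v ^ (p + 1) := by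
    rw [hd, mul_assoc, ← Real.mul_rpow hD0 hG]
    have := qNorm_nonneg (p + 1) v
    gcongr
    exact hD v
  simp only [energy, functionalJ] at hE
  have h3 : 0 ≤ b / 2 * gradNorm v ^ 2 := by positivity
  have h4 : 0 ≤ a / 4 * gradNorm v ^ 4 := by positivity
  have h5 : gradNorm v ≤ R := hR _ (by nlinarith [sq_nonneg ‖w‖])
  have h6 : c * gradNorm v ^ 2 ≤ c * R ^ 2 := by gcongr
  have h7 : d * gradNorm v ^ (p + 1) ≤ d * R ^ (p + 1) := by gcongr
  have h8 : ‖w‖ ≤ √(2 * (|e| + c * R ^ 2 + d * R ^ (p + 1))) :=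
    Real.le_sqrt_of_sq_le (by linarith [le_abs_self e])
  linarith

/-! ### The lower bound at non-positive energy -/

theorem lambda1_mul_norm_sq_le (v : H10 Ω) : lambda1 Ω * ‖toL2 v‖ ^ 2 ≤ gradNorm v ^ 2 := by
  rcases (norm_nonneg (toL2 v)).eq_or_lt with h | h
  · rw [← h]
    simpa using sq_nonneg (gradNorm v)
  have hle : lambda1 Ω ≤ gradNorm (‖toL2 v‖⁻¹ • v) ^ 2 := by
    refine csInf_le ⟨0, ?_⟩ ⟨_, ?_, rfl⟩
    · rintro _ ⟨w, -, rfl⟩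
      exact sq_nonneg _
    · have : toL2 (‖toL2 v‖⁻¹ • v) = ‖toL2 v‖⁻¹ • toL2 v := rfl
      rw [this, norm_smul, norm_inv, norm_norm, inv_mul_cancel₀ h.ne']
  rw [gradNorm_smul, abs_of_pos (inv_pos.2 h), mul_pow, inv_pow, inv_mul_eq_div,
    le_div_iff₀ (by positivity)] at hle
  exact hle

/-- Strict positivity is not needed: with a zero constant the lower bound of part (2) would be 0. -/
theorem sobolevConst_nonneg (Ω : Set E3) (q : ℝ) : 0 ≤ sobolevConst Ω q := by
  refine Real.sInf_nonneg ?_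
  rintro _ ⟨v, -, rfl⟩
  positivity

theorem sobolevConst_mul_qNorm_sq_le (q : ℝ) (v : H10 Ω) :
    sobolevConst Ω q * qNorm q v ^ 2 ≤ gradNorm v ^ 2 := by
  rcases (qNorm_nonneg q v).eq_or_lt with h | h
  · rw [← h]
    simpa using sq_nonneg (gradNorm v)
  have hle : sobolevConst Ω q ≤ gradNorm v ^ 2 / qNorm q v ^ 2 := by
    refine csInf_le ⟨0, ?_⟩ ⟨v, ?_, rfl⟩
    · rintro _ ⟨w, -, rfl⟩
      positivity
    · rintro rfl
      have h0 : qNorm q (0 : H10 Ω) = 0 := by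
        have : (toL2 (0 : H10 Ω) : E3 → ℝ) =ᵐ[volume.restrict Ω] 0 := Lp.coeFn_zero ℝ 2 _
        rw [qNorm, eLpNorm_congr_ae this, eLpNorm_zero, ENNReal.toReal_zero]
      exact h.ne' h0
  rwa [le_div_iff₀ (by positivity)] at hle

theorem bZero_pos (hb : 0 < b) (hlam : lam < b * lambda1 Ω) : 0 < bZero Ω b lam := by
  rw [bZero]
  split_ifs with h
  -- From `0 ≤ λ < b λ₁` and `b > 0` one gets `λ₁ > 0`, with no appeal to Poincaré's inequality.
  · have h1 : 0 < lambda1 Ω := pos_of_mul_pos_right (h.trans_lt hlam) hb.le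
    rw [sub_pos, div_lt_iff₀ h1]
    exact hlam
  · exact hb

theorem bZero_mul_gradNorm_sq_le (hb : 0 < b) (hlam : lam < b * lambda1 Ω) (v : H10 Ω) :
    bZero Ω b lam * gradNorm v ^ 2 ≤ b * gradNorm v ^ 2 - lam * ‖toL2 v‖ ^ 2 := by
  rw [bZero]
  split_ifs with h
  · have h1 : 0 < lambda1 Ω := pos_of_mul_pos_right (h.trans_lt hlam) hb.le
    have h2 := mul_le_mul_of_nonneg_left (lambda1_mul_norm_sq_le v) (div_nonneg h h1.le)
    rw [← mul_assoc, div_mul_cancel₀ _ h1.ne'] at h2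
    linarith
  · nlinarith [sq_nonneg ‖toL2 v‖]

/-- A state of non-positive energy has `∇v = 0` or a gradient bounded below. -/
theorem le_gradNorm_of_energy_nonpos (hp1 : 1 < p) (ha : 0 < a) (hb : 0 < b)
    (hlam : lam < b * lambda1 Ω) {v : H10 Ω} {w : L2 Ω} (hE : energy a b lam p v w ≤ 0)
    (hv : 0 < gradNorm v) :
    ((p + 1) / 2 * bZero Ω b lam * sobolevConst Ω (p + 1) ^ ((p + 1) / 2)) ^ (1 / (p - 1))
      ≤ gradNorm v := by
  have hS := sobolevConst_nonneg Ω (p + 1)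
  have hN := qNorm_nonneg (p + 1) v
  have hb0 := bZero_pos hb hlam
  have hq : 0 < p + 1 := by linarith
  set S := sobolevConst Ω (p + 1)
  set N := qNorm (p + 1) v
  set G := gradNorm v
  have h1 : S ^ ((p + 1) / 2) * N ^ (p + 1) ≤ G ^ (p + 1) := by
    have := Real.rpow_le_rpow (by positivity) (sobolevConst_mul_qNorm_sq_le (p + 1) v)
      (by positivity : 0 ≤ (p + 1) / 2)
    rw [Real.mul_rpow hS (by positivity), ← Real.rpow_natCast, ← Real.rpow_natCast,
      ← Real.rpow_mul hN, ← Real.rpow_mul hv.le] at this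
    simpa [mul_div_cancel₀] using this
  -- The kinetic and quartic terms are nonnegative and are dropped; `b₀` absorbs the `λ` term.
  have h2 : bZero Ω b lam / 2 * G ^ 2 ≤ 1 / (p + 1) * N ^ (p + 1) := by
    have h3 := bZero_mul_gradNorm_sq_le hb hlam v
    have h4 : 0 ≤ a / 4 * G ^ 4 := by positivity
    simp only [energy, functionalJ] at hE
    nlinarith [sq_nonneg ‖w‖]
  have h5 : (p + 1) / 2 * bZero Ω b lam * G ^ 2 ≤ N ^ (p + 1) := by
    have := mul_le_mul_of_nonneg_left h2 hq.le
    rw [← mul_assoc (p + 1) (1 / (p + 1)), mul_one_div_cancel hq.ne', one_mul] at this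
    linarith
  have h6 : (p + 1) / 2 * bZero Ω b lam * S ^ ((p + 1) / 2) ≤ G ^ (p - 1) := by
    have h7 := (mul_le_mul_of_nonneg_left h5 (Real.rpow_nonneg hS ((p + 1) / 2))).trans h1
    have h8 : G ^ (p + 1) = G ^ (p - 1) * G ^ 2 := by
      rw [← Real.rpow_natCast G 2, ← Real.rpow_add hv]
      norm_num
      ring_nf
    rw [h8, ← mul_assoc] at h7
    -- Dividing by `G²` is where a nonzero gradient is needed; the power `p - 1 > 0` that remains
    -- gives the lower bound.
    have := le_of_mul_le_mul_right h7 (by positivity)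
    linarith
  have h9 := Real.rpow_le_rpow (by positivity) h6 (by
    rw [one_div, inv_nonneg]; linarith : 0 ≤ 1 / (p - 1))
  rwa [one_div, Real.rpow_rpow_inv hv.le (by linarith), ← one_div] at h9

/-- At every time the gradient norm is 0 or at least `α`. It is at least `α` initially, so reaching
0 would force an intermediate value in the forbidden gap. -/
theorem IsSolution.le_gradNorm (hbd : Bornology.IsBounded Ω) (hp1 : 1 < p) (hp : p + 1 ≤ 6)
    (ha : 0 < a) (hb : 0 < b) (hlam : lam < b * lambda1 Ω)
    (hu : IsSolution a b lam p u₀ u₁ T u)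
    (hE : energy a b lam p (toH10 u₀) (toL2 u₁) ≤ 0) (hG : 0 < gradNorm (toH10 u₀))
    {t : ℝ} (ht : t ∈ timeInterval T) :
    ((p + 1) / 2 * bZero Ω b lam * sobolevConst Ω (p + 1) ^ ((p + 1) / 2)) ^ (1 / (p - 1))
      ≤ gradNorm (toH10 (u t)) := by
  have hα : ∀ s ∈ timeInterval T, 0 < gradNorm (toH10 (u s)) →
      ((p + 1) / 2 * bZero Ω b lam * sobolevConst Ω (p + 1) ^ ((p + 1) / 2)) ^ (1 / (p - 1))
        ≤ gradNorm (toH10 (u s)) := fun s hs hpos =>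
    le_gradNorm_of_energy_nonpos hp1 ha hb hlam
      ((hu.energy_eq hbd (by linarith) hp hs).trans_le hE) hpos
  set α := ((p + 1) / 2 * bZero Ω b lam * sobolevConst Ω (p + 1) ^ ((p + 1) / 2)) ^ (1 / (p - 1))
  by_contra! hlt
  have h0 := zero_mem_timeInterval hu.pos
  have hzero : gradNorm (toH10 (u t)) = 0 := by
    by_contra hne
    exact hlt.not_ge (hα t ht ((gradNorm_nonneg _).lt_of_ne' hne))
  have hα0 : 0 < α := hzero ▸ hlt
  have hstart : α ≤ gradNorm (toH10 (u 0)) := hα 0 h0 (by rwa [hu.initial])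
  obtain ⟨s, hs, hsα⟩ := (ordConnected_timeInterval T).isPreconnected.intermediate_value ht h0
    ((continuous_gradNorm.comp continuous_toH10).comp_continuousOn hu.memH.continuous_H2)
    -- Any value strictly between 0 and `α` would serve.
    (show α / 2 ∈ Icc (gradNorm (toH10 (u t))) (gradNorm (toH10 (u 0))) from
      ⟨by rw [hzero]; positivity, by linarith⟩)
  replace hsα : gradNorm (toH10 (u s)) = α / 2 := hsα
  have := hα s hs (by rw [hsα]; positivity)
  linarith

end Kirchhoff

end

theorem theorem2p2 (Ω : Set E3) (hΩ : IsSmoothBoundedDomain Ω)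
    (p a b lam : ℝ) (hp1 : 1 < p) (hp3 : p < 3) (ha : 0 < a) (hb : 0 < b)
    (u₀ : H2H10 Ω) (u₁ : H10 Ω) (Tmax : EReal) (u : ℝ → H2H10 Ω)
    (hu : IsMaximalSolution a b lam p u₀ u₁ Tmax u) :
    (∃ K₁ : ℝ, 0 < K₁ ∧ ∀ t ∈ timeInterval Tmax,
      ‖velocity Tmax u t‖ + gradNorm (toH10 (u t)) ≤ K₁) ∧
    (lam < b * lambda1 Ω → energy a b lam p (toH10 u₀) (toL2 u₁) ≤ 0 → 0 < gradNorm (toH10 u₀) →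
      ∀ t ∈ timeInterval Tmax,
        ((p + 1) / 2 * bZero Ω b lam * sobolevConst Ω (p + 1) ^ ((p + 1) / 2)) ^ (1 / (p - 1))
          ≤ gradNorm (toH10 (u t))) := by
  have hbd := hΩ.isBounded
  have hs := hu.isSolution
  refine ⟨?_, fun hlam hE hG t ht =>
    hs.le_gradNorm hbd hp1 (by linarith) ha hb hlam hE hG ht⟩
  -- All states of the solution lie in the sublevel set of the initial energy, so one constant
  -- serves for all times.
  obtain ⟨K, hK0, hK⟩ := exists_bound_of_energy_le hbd (by linarith) hp3 ha hb lam
    (energy a b lam p (toH10 u₀) (toL2 u₁))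
  exact ⟨K, hK0, fun t ht => hK _ _ (hs.energy_eq hbd (by linarith) (by linarith) ht).le⟩
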